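/- Let $H=(H_1,\dots,H_N):\mathbf R_+^N\to(0,1)^N$ be a measurable function. For $t\in\mathbf R_+^N$ put, for $u,\xi\in\mathbf R^N$, $$\kappa_t(u)=\prod_{i=1}^N\Big(|t_i-u_i|^{H_i(t)-\frac12}-|u_i|^{H_i(t)-\frac12}\Big),\qquad \phi_t(\xi)=\prod_{m=1}^N\frac{e^{it_m\xi_m}-1}{|\xi_m|^{H_m(t)+\frac12}} .$$ Then $\kappa_t,\phi_t\in L^2_{\mathbf C}(\mathbf R^N)$ for every $t$. Let $W=\{W(f);f\in L^2_{\mathbf C}(\mathbf R^N)\}$ be a complex isonormal process (a centered Gaussian process with $E[W(f)\overline{W(g)}]=\int f\overline g\,du$), and let $\hat W$ be its Fourier transform: $\hat W(f)=W(\hat f)$ almost surely for every $f$, where $\hat f(x)=\int e^{-i\langle x,u\rangle}f(u)\,du$ (extended to $L^2$ by Plancherel). Let $Y_t=W(\kappa_t)=\int\kappa_t\,d\mathbb W$ be the multifractional Brownian sheet (moving-average definition), and let $X_t=\hat W(\phi_t)=\int\phi_t\,d\hat{\mathbb W}$. Then $X$ and $Y$ are indistinguishable up to a deterministic multiplicative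 function, so that $X$ is the harmonizable representation of the multifractional Brownian sheet. Precisely, there is a deterministic function $\lambda:\mathbf R_+^N\to\mathbf R$, depending only on $N$ and $H$ (not on the probability space or on $W$), with $\lambda(t)\neq0$ whenever $H_m(t)\neq\frac12$ for all $m$, such that 1. for every $t\in\mathbf R_+^N$, almost surely $Y_t=\lambda(t)X_t$; 2. if $\tilde Y$ and $\tilde X$ are modifications of $Y$ and $X$ whose sample paths are almost surely continuous, or, more generally, such that almost surely $\tilde Y_s\to\tilde Y_t$ and $\tilde X_s\to\tilde X_t$ whenever $s\to t$ and $H(s)\to H(t)$, then almost surely $\tilde Y_t=\lambda(t)\tilde X_t$ for all $t\in\mathbf R_+^N$ simultaneously. -/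

import Mathlib

open MeasureTheory ProbabilityTheory Filter Topology
open scoped FourierTransform NNReal ENNReal ComplexConjugate

noncomputable section

namespace MBS

/-- The space `ℝ^N` carrying the white noise, with its Euclidean structure and Lebesgue measure. -/
abbrev Space (N : ℕ) : Type := EuclideanSpace ℝ (Fin N)

/-- The index set `ℝ₊^N` of the processes. -/
abbrev Index (N : ℕ) : Type := Fin N → ℝ≥0

/-- The space `L²_ℂ(ℝ^N)`. -/
abbrev L2 (N : ℕ) : Type := Lp (α := Space N) ℂ 2 volume

/-- The map `x ↦ x / (2π)` on `ℝ^N` preserves square integrability under composition. -/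
theorem memLp_comp_scale {N : ℕ} {f : Space N → ℂ} (hf : MemLp f 2 volume) :
    MemLp (fun x : Space N => f ((2 * Real.pi)⁻¹ • x)) 2 volume := by
  have hr : ((2 * Real.pi)⁻¹ : ℝ) ≠ 0 := by positivity
  have hm : Measurable (fun x : Space N => (2 * Real.pi)⁻¹ • x) := measurable_const_smul _
  have h1 : MemLp f 2 (Measure.map (fun x : Space N => (2 * Real.pi)⁻¹ • x) volume) := by
    rw [Measure.map_addHaar_smul volume hr]
    exact hf.smul_measure ENNReal.ofReal_ne_top
  exact h1.comp_of_map hm.aemeasurable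

/-- The Fourier transform `f̂(x) = ∫ e^{-i⟨x,u⟩} f(u) du` on `L²_ℂ(ℝ^N)` (extended from integrable
functions by Plancherel). Mathlib's `𝓕` uses the kernel `e^{-2πi⟨x,u⟩}`, so `f̂(x) = (𝓕 f)(x / 2π)`. -/
def fourierL2 {N : ℕ} (f : L2 N) : L2 N :=
  (memLp_comp_scale (Lp.memLp (𝓕 f))).toLp _

/-- A complex isonormal process: a centered Gaussian family indexed by `L²_ℂ(ℝ^N)` with
`E[W(f) conj W(g)] = ∫ f conj g`. -/
structure IsComplexIsonormal {N : ℕ} {Ω : Type*} [MeasurableSpace Ω]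
    (W : L2 N → Ω → ℂ) (P : Measure Ω) : Prop where
  gaussian : IsGaussianProcess W P
  centered : ∀ f, ∫ ω, W f ω ∂P = 0
  covariance : ∀ f g : L2 N, ∫ ω, W f ω * conj (W g ω) ∂P = ∫ u, f u * conj (g u)

/-- `What` is the Fourier transform of the process `W`: `What(f) = W(f̂)` almost surely,
for every `f`. -/
def IsFourierTransform {N : ℕ} {Ω : Type*} [MeasurableSpace Ω]
    (What W : L2 N → Ω → ℂ) (P : Measure Ω) : Prop :=
  ∀ f : L2 N, What f =ᵐ[P] W (fourierL2 f)

open Classical in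
/-- The stochastic integral `∫ f(u) 𝕎(du) = W(f)` of a function `f` on `ℝ^N`; it is meaningful
for square integrable `f`, and set to `0` for all other `f`. -/
def stochInt {N : ℕ} {Ω : Type*} (W : L2 N → Ω → ℂ) (f : Space N → ℂ) : Ω → ℂ :=
  if hf : MemLp f 2 volume then W (hf.toLp f) else 0

/-- The moving average kernel
`u ↦ ∏ᵢ (|tᵢ - uᵢ|^(Hᵢ(t) - 1/2) - |uᵢ|^(Hᵢ(t) - 1/2))`. -/
def maKernel {N : ℕ} (H : Index N → Fin N → ℝ) (t : Index N) (u : Space N) : ℂ :=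
  ∏ i, (((|(t i : ℝ) - u i| ^ (H t i - 1 / 2) - |u i| ^ (H t i - 1 / 2) : ℝ)) : ℂ)

/-- The harmonizable kernel
`φ_t : ξ ↦ ∏ₘ (e^(i tₘ ξₘ) - 1) / |ξₘ|^(Hₘ(t) + 1/2)`. -/
def harmKernel {N : ℕ} (H : Index N → Fin N → ℝ) (t : Index N) (ξ : Space N) : ℂ :=
  ∏ m, (Complex.exp (Complex.I * ((t m : ℝ) : ℂ) * (ξ m : ℂ)) - 1) /
    ((|ξ m| ^ (H t m + 1 / 2) : ℝ) : ℂ)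

/-- The multifractional Brownian sheet with Hurst function `H`, defined from `W`. -/
def mBs {N : ℕ} {Ω : Type*} (W : L2 N → Ω → ℂ) (H : Index N → Fin N → ℝ) :
    Index N → Ω → ℂ :=
  fun t => stochInt W (maKernel H t)

/-- The harmonizable process `Ŵ(φ_t)`, defined from `What`. -/
def harmProcess {N : ℕ} {Ω : Type*} (What : L2 N → Ω → ℂ) (H : Index N → Fin N → ℝ) :
    Index N → Ω → ℂ :=
  fun t => stochInt What (harmKernel H t)

/-- `X'` is a modification (version) of `X`. -/
def IsModification {T Ω : Type*} [MeasurableSpace Ω] (X' X : T → Ω → ℂ) (P : Measure Ω) : Prop :=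
  ∀ t, X' t =ᵐ[P] X t

/-- A path `x` on `ℝ₊^N` is continuous along `H` if `x(s) → x(t)` whenever `s → t` and
`H(s) → H(t)`. A continuous path has this property; for continuous `H` it is plain continuity. -/
def ContinuousAlong {N : ℕ} (H : Index N → Fin N → ℝ) (x : Index N → ℂ) : Prop :=
  ∀ t, Tendsto x (𝓝 t ⊓ comap H (𝓝 (H t))) (𝓝 (x t))

end MBS

end

/-! With `a = H + 1/2`, both kernels are products over coordinates. The claim is that each moving
average factor |t-u|^(a-1) - |u|^(a-1) is `ratio a = Γ(a) cos(πa/2) / π` times the Fourier transform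
of the harmonizable factor (e^(itx) - 1)/|x|^a. Then κ_t = λ(t) φ̂_t almost everywhere, where λ(t)
is the product of the ratios, and almost surely W(κ_t) = λ(t) W(φ̂_t) = λ(t) Ŵ(φ_t).

The Fourier integral of the harmonizable factor need not converge absolutely, so the two sides are
compared through their integrals over boxes, which determine a locally integrable function. By
Parseval, the integral of φ̂_t over a box is the integral of φ_t against the transform of the box's
indicator. It splits into one-dimensional integrals, which now converge absolutely because the
indicator's transform decays like 1/|x|. Folding x and -x together leaves four sines against
x^(-1-a). These integrals come from the Mellin transform of sin, obtained from its Laplace transform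
and the reflection formula for Γ. On the other side |u|^(a-1) has an explicit primitive, and the two
results are proportional (`ratio_mul_integral_harmFactor`).

For the simultaneous statement, the equality holds off one null set at all points of a countable set
D that is dense for the topology induced by t ↦ (t, H(t)). Both paths are continuous for that
topology, and so is λ, being a continuous function of H. Hence the equality extends from D to every
t. -/

namespace MBS

open Set Real
open scoped Pointwise

/-! ### Mellin transforms of sin x and sin x - x. -/

/-- Integrability on `(0, ∞)` from power bounds with exponents above and below `-1`. -/
theorem integrableOn_Ioi_of_norm_le {E : Type*} [NormedAddCommGroup E] {F : ℝ → E}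
    (hF : AEStronglyMeasurable F (volume.restrict (Ioi 0))) {A B r s : ℝ} (hr : -1 < r)
    (hs : s < -1) (h0 : ∀ x, 0 < x → ‖F x‖ ≤ A * x ^ r) (h1 : ∀ x, 0 < x → ‖F x‖ ≤ B * x ^ s) :
    IntegrableOn F (Ioi 0) := by
  rw [← Ioc_union_Ioi_eq_Ioi (zero_le_one' ℝ), integrableOn_union]
  constructor
  · refine Integrable.mono' (g := fun x => A * x ^ r) ?_ (hF.mono_set Ioc_subset_Ioi_self) ?_
    · have := (intervalIntegral.intervalIntegrable_rpow' (a := 0) (b := 1) hr)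
      rw [intervalIntegrable_iff_integrableOn_Ioc_of_le zero_le_one] at this
      exact this.const_mul A
    · exact (ae_restrict_iff' measurableSet_Ioc).2 (.of_forall fun x hx => h0 x hx.1)
  · refine Integrable.mono' (g := fun x => B * x ^ s) ?_
      (hF.mono_set (Ioi_subset_Ioi zero_le_one)) ?_
    · exact (integrableOn_Ioi_rpow_of_lt hs one_pos).const_mul B
    · exact (ae_restrict_iff' measurableSet_Ioi).2
        (.of_forall fun x hx => h1 x (one_pos.trans hx))

/-- `∫₀^∞ s^b / (1 + s²) ds = π / (2 cos (π b / 2))` for `|b| < 1`. -/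
theorem integral_rpow_div_one_add_sq {b : ℝ} (h1 : -1 < b) (h2 : b < 1) :
    ∫ s in Ioi (0 : ℝ), s ^ b / (1 + s ^ 2) = π / (2 * cos (π * b / 2)) := by
  set c : ℝ := (b + 1) / 2 with hc
  have hc0 : 0 < c := by rw [hc]; linarith
  have hc1 : 0 < 1 - c := by rw [hc]; linarith
  -- Write 1/(1+s²) as ∫ e^(-(1+s²)y) dy over y > 0 and integrate in s first: this gives Γ(c) y^(-c)
  -- e^(-y)/2. The y-integral then produces Γ(c) Γ(1-c), and the reflection formula applies.
  have key : ∀ y ∈ Ioi (0 : ℝ), ∫ s in Ioi (0 : ℝ), s ^ b * exp (-((1 + s ^ 2) * y))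
      = (1 / 2 * Gamma c) * (exp (-y) * y ^ ((1 - c) - 1)) := by
    intro y hy
    have := integral_rpow_mul_exp_neg_mul_rpow (p := 2) (q := b) (b := y) two_pos h1 hy
    calc _ = ∫ s in Ioi (0 : ℝ), exp (-y) * (s ^ b * exp (-y * s ^ (2 : ℝ))) := by
          refine setIntegral_congr_fun measurableSet_Ioi fun s _ => ?_
          simp only [rpow_two]
          rw [mul_left_comm, ← exp_add]
          congr 2; ring
      _ = _ := by
          rw [integral_const_mul, this]
          have : -(b + 1) / 2 = 1 - c - 1 := by rw [hc]; ring
          rw [this]; ring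
  have hint : Integrable (Function.uncurry fun s y : ℝ => s ^ b * exp (-((1 + s ^ 2) * y)))
      ((volume.restrict (Ioi 0)).prod (volume.restrict (Ioi 0))) := by
    rw [integrable_prod_iff']
    · constructor
      · refine (ae_restrict_iff' measurableSet_Ioi).2 (.of_forall fun y hy => ?_)
        refine ((integrableOn_rpow_mul_exp_neg_mul_rpow (p := 2) h1 two_pos hy).const_mul
          (exp (-y))).congr ?_
        refine .of_forall fun s => ?_
        simp only [rpow_two, Function.uncurry]
        rw [mul_left_comm, ← exp_add]
        congr 2; ring
      · have := (GammaIntegral_convergent hc1).const_mul (1 / 2 * Gamma c)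
        refine this.congr ((ae_restrict_iff' measurableSet_Ioi).2 (.of_forall fun y hy => ?_))
        simp only
        rw [← key y hy]
        refine setIntegral_congr_fun measurableSet_Ioi fun s hs => ?_
        simp only [Function.uncurry]
        rw [norm_of_nonneg]
        exact mul_nonneg (rpow_nonneg (le_of_lt hs) _) (exp_nonneg _)
    · exact (Measurable.aestronglyMeasurable (by fun_prop))
  have hswap := integral_integral_swap hint
  have hL : ∀ s ∈ Ioi (0 : ℝ), ∫ y in Ioi (0 : ℝ), s ^ b * exp (-((1 + s ^ 2) * y))
      = s ^ b / (1 + s ^ 2) := by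
    intro s hs
    rw [integral_const_mul]
    have := integral_exp_mul_Ioi (a := -(1 + s ^ 2)) (by nlinarith [sq_nonneg s]) 0
    simp only [neg_mul] at this
    rw [this]
    rw [mul_zero, neg_zero, exp_zero, neg_div_neg_eq, mul_one_div]
  rw [setIntegral_congr_fun measurableSet_Ioi hL, setIntegral_congr_fun measurableSet_Ioi key,
    integral_const_mul, ← Gamma_eq_integral hc1, mul_assoc, Gamma_mul_Gamma_one_sub] at hswap
  rw [hswap, show π * c = π * b / 2 + π / 2 by rw [hc]; ring, sin_add_pi_div_two]
  rw [one_div, inv_mul_eq_div, div_div, mul_comm 2]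

/-- Mellin transform of `f` in terms of its Laplace transform. -/
theorem Gamma_mul_integral_eq {a : ℝ} (ha : 0 < 1 + a) {f : ℝ → ℝ} (hf : Measurable f)
    (hint : IntegrableOn (fun x => f x * x ^ (-1 - a)) (Ioi 0)) :
    Gamma (1 + a) * ∫ x in Ioi (0 : ℝ), f x * x ^ (-1 - a)
      = ∫ s in Ioi (0 : ℝ), s ^ a * ∫ x in Ioi (0 : ℝ), f x * exp (-(s * x)) := by
  -- The power x^(-1-a) is itself a Laplace transform; substituting it and applying Fubini gives the
  -- claim.
  have key : ∀ x ∈ Ioi (0 : ℝ), ∫ s in Ioi (0 : ℝ), s ^ a * exp (-(s * x))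
      = Gamma (1 + a) * x ^ (-1 - a) := by
    intro x hx
    have := integral_rpow_mul_exp_neg_mul_Ioi ha hx
    rw [one_div, inv_rpow (le_of_lt hx), ← rpow_neg (le_of_lt hx), mul_comm, neg_add'] at this
    rw [← this]
    refine setIntegral_congr_fun measurableSet_Ioi fun s _ => ?_
    rw [mul_comm s x, add_sub_cancel_left]
  have hfub : Integrable (Function.uncurry fun s x : ℝ => s ^ a * (f x * exp (-(s * x))))
      ((volume.restrict (Ioi 0)).prod (volume.restrict (Ioi 0))) := by
    rw [integrable_prod_iff']
    · constructor
      · refine (ae_restrict_iff' measurableSet_Ioi).2 (.of_forall fun x hx => ?_)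
        refine ((integrableOn_rpow_mul_exp_neg_mul_rpow (p := 1) (s := a) (by linarith) one_pos
          hx).const_mul (f x)).congr ?_
        refine .of_forall fun s => ?_
        simp only [rpow_one, Function.uncurry]
        rw [mul_left_comm, neg_mul, mul_comm x s]
      · refine (hint.norm.const_mul (Gamma (1 + a))).congr
          ((ae_restrict_iff' measurableSet_Ioi).2 (.of_forall fun x hx => ?_))
        simp only
        rw [norm_mul, norm_of_nonneg (rpow_nonneg (le_of_lt hx) _), mul_left_comm, ← key x hx,
          ← integral_const_mul]
        refine setIntegral_congr_fun measurableSet_Ioi fun s hs => ?_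
        simp only [Function.uncurry, norm_mul]
        rw [norm_of_nonneg (rpow_nonneg (le_of_lt hs) _), norm_of_nonneg (exp_nonneg _)]
        ring
    · exact (Measurable.aestronglyMeasurable (by fun_prop))
  have hswap := integral_integral_swap hfub
  simp only [integral_const_mul] at hswap
  rw [hswap, ← integral_const_mul]
  refine setIntegral_congr_fun measurableSet_Ioi fun x hx => ?_
  rw [mul_left_comm, ← key x hx, ← integral_const_mul]
  refine setIntegral_congr_fun measurableSet_Ioi fun s _ => ?_
  ring

/-- Laplace transform of the sine. -/
theorem integral_sin_mul_exp_neg {s : ℝ} (hs : 0 < s) :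
    ∫ x in Ioi (0 : ℝ), sin x * exp (-(s * x)) = 1 / (1 + s ^ 2) := by
  have hre : (Complex.I - s).re < 0 := by simpa using hs
  have h := integral_exp_mul_complex_Ioi hre 0
  have hi := integrableOn_exp_mul_complex_Ioi hre 0
  have h2 := congrArg Complex.im h
  rw [show (∫ x : ℝ in Ioi 0, Complex.exp ((Complex.I - s) * x)).im
    = ∫ x : ℝ in Ioi 0, (Complex.exp ((Complex.I - s) * x)).im from
      (integral_im (𝕜 := ℂ) hi).symm] at h2
  convert h2 using 1
  · refine setIntegral_congr_fun measurableSet_Ioi fun x _ => ?_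
    simp only [Complex.exp_im]
    simp [mul_comm]
  · simp [Complex.div_im, Complex.normSq_apply]
    ring

theorem integral_id_mul_exp_neg {s : ℝ} (hs : 0 < s) :
    ∫ x in Ioi (0 : ℝ), x * exp (-(s * x)) = 1 / s ^ 2 := by
  have := integral_rpow_mul_exp_neg_mul_Ioi (a := 2) two_pos hs
  rw [Gamma_two, mul_one, rpow_two, one_div_pow] at this
  rw [← this]
  refine setIntegral_congr_fun measurableSet_Ioi fun x _ => ?_
  norm_num

theorem abs_sin_sub_self_le {x : ℝ} (hx : 0 < x) : |sin x - x| ≤ x ^ 3 / 6 := by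
  rw [abs_le]
  constructor <;> nlinarith [sin_gt_sub_cube hx, sin_lt hx, pow_pos hx 3]

theorem integrableOn_sin_mul_rpow {a : ℝ} (h0 : 0 < a) (h1 : a < 1) :
    IntegrableOn (fun x => sin x * x ^ (-1 - a)) (Ioi 0) := by
  refine integrableOn_Ioi_of_norm_le (Measurable.aestronglyMeasurable (by fun_prop))
    (A := 1) (B := 1) (r := -a) (s := -1 - a) (by linarith) (by linarith) ?_ ?_
  · intro x hx
    rw [norm_mul, norm_of_nonneg (rpow_nonneg hx.le _), one_mul]
    calc _ ≤ x * x ^ (-1 - a) := by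
          gcongr
          simpa [abs_of_pos hx] using abs_sin_le_abs (x := x)
      _ = _ := by rw [mul_comm, ← rpow_add_one hx.ne']; congr 1; ring
  · intro x hx
    rw [norm_mul, norm_of_nonneg (rpow_nonneg hx.le _)]
    gcongr
    exact abs_sin_le_one x

theorem integrableOn_sin_sub_mul_rpow {a : ℝ} (h0 : 1 < a) (h1 : a < 3) :
    IntegrableOn (fun x => (sin x - x) * x ^ (-1 - a)) (Ioi 0) := by
  refine integrableOn_Ioi_of_norm_le (Measurable.aestronglyMeasurable (by fun_prop))
    (A := 1 / 6) (B := 2) (r := 2 - a) (s := - a) (by linarith) (by linarith) ?_ ?_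
  · intro x hx
    rw [norm_mul, norm_of_nonneg (rpow_nonneg hx.le _)]
    calc _ ≤ x ^ 3 / 6 * x ^ (-1 - a) := by
          gcongr
          exact abs_sin_sub_self_le hx
      _ = 1 / 6 * (x ^ (3 : ℝ) * x ^ (-1 - a)) := by norm_cast; ring
      _ = _ := by rw [← rpow_add hx]; congr 2; ring
  · intro x hx
    rw [norm_mul, norm_of_nonneg (rpow_nonneg hx.le _)]
    calc _ ≤ (2 * x) * x ^ (-1 - a) := by
          gcongr
          rw [Real.norm_eq_abs, abs_le]
          have := abs_le.1 (abs_sin_le_abs (x := x))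
          rw [abs_of_pos hx] at this
          constructor <;> linarith
      _ = 2 * (x ^ (-1 - a) * x) := by ring
      _ = _ := by rw [← rpow_add_one hx.ne']; congr 2; ring

/-- The value of the (regularized) integral `∫₀^∞ sin x / x^(1+a) dx`. -/
noncomputable def sinConst (a : ℝ) : ℝ := π / (2 * Gamma (1 + a) * cos (π * a / 2))

theorem integral_sin_mul_rpow {a : ℝ} (h0 : 0 < a) (h1 : a < 1) :
    ∫ x in Ioi (0 : ℝ), sin x * x ^ (-1 - a) = sinConst a := by
  have hG : 0 < Gamma (1 + a) := Gamma_pos_of_pos (by linarith)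
  have h := Gamma_mul_integral_eq (a := a) (by linarith) measurable_sin
    (integrableOn_sin_mul_rpow h0 h1)
  have hL : ∀ s ∈ Ioi (0 : ℝ), s ^ a * ∫ x in Ioi (0 : ℝ), sin x * exp (-(s * x))
      = s ^ a / (1 + s ^ 2) := fun s hs => by rw [integral_sin_mul_exp_neg hs, mul_one_div]
  rw [setIntegral_congr_fun measurableSet_Ioi hL,
    integral_rpow_div_one_add_sq (by linarith) h1] at h
  rw [mul_comm, ← eq_div_iff hG.ne'] at h
  rw [h, sinConst, div_div]; congr 1; ring

/-- Removing the linear term carries the formula past the pole at `a = 1`. The Laplace transform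
becomes -1/(s²(1+s²)), which shifts the exponent to a - 2 in (-1, 1); its sign cancels against
cos(π(a-2)/2) = -cos(πa/2), so the constant is again `sinConst a`. -/
theorem integral_sin_sub_mul_rpow {a : ℝ} (h0 : 1 < a) (h1 : a < 3) :
    ∫ x in Ioi (0 : ℝ), (sin x - x) * x ^ (-1 - a) = sinConst a := by
  have hG : 0 < Gamma (1 + a) := Gamma_pos_of_pos (by linarith)
  have h := Gamma_mul_integral_eq (a := a) (by linarith) (f := fun x => sin x - x) (by fun_prop)
    (integrableOn_sin_sub_mul_rpow h0 h1)
  have hL : ∀ s ∈ Ioi (0 : ℝ), s ^ a * ∫ x in Ioi (0 : ℝ), (sin x - x) * exp (-(s * x))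
      = - (s ^ (a - 2) / (1 + s ^ 2)) := by
    intro s hs
    have hs' : (0 : ℝ) < s := hs
    have e1 : ∫ x in Ioi (0 : ℝ), (sin x - x) * exp (-(s * x))
        = 1 / (1 + s ^ 2) - 1 / s ^ 2 := by
      rw [← integral_sin_mul_exp_neg hs', ← integral_id_mul_exp_neg hs', ← integral_sub]
      · simp only [sub_mul]
      · refine Integrable.mono' (integrableOn_exp_mul_Ioi (a := -s) (by linarith) 0)
          (Measurable.aestronglyMeasurable (by fun_prop)) (.of_forall fun x => ?_)
        rw [norm_mul, norm_of_nonneg (exp_nonneg _), neg_mul]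
        exact mul_le_of_le_one_left (exp_nonneg _) (abs_sin_le_one x)
      · have := integrableOn_rpow_mul_exp_neg_mul_rpow (p := 1) (s := 1) (b := s)
          (by norm_num) one_pos hs'
        simpa only [rpow_one, neg_mul, IntegrableOn] using this
    rw [e1, rpow_sub hs', rpow_two]
    field_simp
    ring
  have hc : cos (π * (a - 2) / 2) = - cos (π * a / 2) := by
    rw [show π * (a - 2) / 2 = π * a / 2 - π by ring, cos_sub_pi]
  rw [setIntegral_congr_fun measurableSet_Ioi hL, integral_neg,
    integral_rpow_div_one_add_sq (by linarith) (by linarith), hc] at h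
  rw [mul_comm, ← eq_div_iff hG.ne'] at h
  rw [h, sinConst, mul_neg, div_neg, neg_neg, div_div]; congr 1; ring

/-! ### Rescaled odd functions and odd powers. -/

/-- The odd power function `sign x * |x| ^ a`. -/
noncomputable def signPow (a x : ℝ) : ℝ := (SignType.sign x : ℝ) * |x| ^ a

theorem signPow_of_pos {a x : ℝ} (hx : 0 < x) : signPow a x = x ^ a := by
  simp [signPow, hx, abs_of_pos hx]

@[simp] theorem signPow_zero (a : ℝ) : signPow a 0 = 0 := by simp [signPow]

@[simp] theorem signPow_neg (a x : ℝ) : signPow a (-x) = -signPow a x := by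
  simp [signPow, Left.sign_neg]

theorem integrableOn_odd_comp_mul {g : ℝ → ℝ} (hg : ∀ x, g (-x) = -g x) {a : ℝ}
    (hint : IntegrableOn (fun y => g y * y ^ (-1 - a)) (Ioi 0)) (x : ℝ) :
    IntegrableOn (fun y => g (x * y) * y ^ (-1 - a)) (Ioi 0) := by
  have pos : ∀ x : ℝ, 0 < x → IntegrableOn (fun y => g (x * y) * y ^ (-1 - a)) (Ioi 0) := by
    intro x hx
    have h := (integrableOn_Ioi_comp_mul_left_iff (fun y => g y * y ^ (-1 - a)) 0 hx).2
      (by simpa using hint)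
    refine (h.const_mul (x ^ (1 + a))).congr
      ((ae_restrict_iff' measurableSet_Ioi).2 (.of_forall fun y hy => ?_))
    simp only
    rw [mul_rpow hx.le (le_of_lt hy), mul_left_comm, ← mul_assoc (x ^ (1 + a)), ← rpow_add hx]
    simp
  have h0 : g 0 = 0 := by have := hg 0; rw [neg_zero] at this; linarith
  rcases lt_trichotomy x 0 with hx | rfl | hx
  · have := (pos (-x) (by linarith)).neg
    refine this.congr (.of_forall fun y => ?_)
    simp only [Pi.neg_apply, neg_mul, hg, neg_neg]
  · simp [h0]
  · exact pos x hx

theorem integral_odd_comp_mul {g : ℝ → ℝ} (hg : ∀ x, g (-x) = -g x) (a x : ℝ) :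
    ∫ y in Ioi (0 : ℝ), g (x * y) * y ^ (-1 - a)
      = (∫ y in Ioi (0 : ℝ), g y * y ^ (-1 - a)) * signPow a x := by
  have pos : ∀ x : ℝ, 0 < x → ∫ y in Ioi (0 : ℝ), g (x * y) * y ^ (-1 - a)
      = (∫ y in Ioi (0 : ℝ), g y * y ^ (-1 - a)) * signPow a x := by
    intro x hx
    have h := integral_comp_mul_left_Ioi (fun y => g y * y ^ (-1 - a)) 0 hx
    rw [mul_zero, smul_eq_mul, inv_mul_eq_div, eq_div_iff hx.ne'] at h
    rw [← h, signPow_of_pos hx, mul_assoc, mul_comm x, ← rpow_add_one hx.ne', ← integral_mul_const]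
    refine setIntegral_congr_fun measurableSet_Ioi fun y hy => ?_
    rw [mul_rpow hx.le (le_of_lt hy), mul_assoc, mul_right_comm, ← rpow_add hx,
      show -1 - a + (a + 1) = 0 by ring, rpow_zero, one_mul]
  have h0 : g 0 = 0 := by have := hg 0; rw [neg_zero] at this; linarith
  rcases lt_trichotomy x 0 with hx | rfl | hx
  · have h := pos (-x) (by linarith)
    rw [signPow_neg, mul_neg, ← neg_eq_iff_eq_neg, ← integral_neg] at h
    simpa only [neg_mul, hg, neg_neg] using h
  · simp [h0]
  · exact pos x hx

/-- The condition `hx` cancels the linear terms, so sin may be replaced by sin x - x when `a > 1`.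
One formula thus serves both sides of `a = 1`. -/
theorem integral_sin_sum_mul_rpow {a : ℝ} (h0 : 0 < a) (h1 : a ≠ 1) (h2 : a < 3)
    {x₁ x₂ x₃ x₄ : ℝ} (hx : x₁ - x₂ + x₃ - x₄ = 0) :
    ∫ y in Ioi (0 : ℝ), (sin (x₁ * y) - sin (x₂ * y) + sin (x₃ * y) - sin (x₄ * y)) * y ^ (-1 - a)
      = sinConst a * (signPow a x₁ - signPow a x₂ + signPow a x₃ - signPow a x₄) := by
  obtain ⟨g, hg, hint, hval, hsum⟩ : ∃ g : ℝ → ℝ, (∀ x, g (-x) = -g x) ∧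
      IntegrableOn (fun y => g y * y ^ (-1 - a)) (Ioi 0) ∧
      ∫ y in Ioi (0 : ℝ), g y * y ^ (-1 - a) = sinConst a ∧
      ∀ y, sin (x₁ * y) - sin (x₂ * y) + sin (x₃ * y) - sin (x₄ * y)
        = g (x₁ * y) - g (x₂ * y) + g (x₃ * y) - g (x₄ * y) := by
    rcases lt_or_gt_of_ne h1 with h | h
    · exact ⟨sin, sin_neg, integrableOn_sin_mul_rpow h0 h, integral_sin_mul_rpow h0 h,
        fun _ => rfl⟩
    · refine ⟨fun x => sin x - x, fun x => by simp only [sin_neg]; ring,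
        integrableOn_sin_sub_mul_rpow h h2, integral_sin_sub_mul_rpow h h2, fun y => ?_⟩
      linear_combination y * hx
  have hi := integrableOn_odd_comp_mul hg hint
  have hi₂ : IntegrableOn (fun y => g (x₁ * y) * y ^ (-1 - a) - g (x₂ * y) * y ^ (-1 - a))
    (Ioi 0) := (hi x₁).sub (hi x₂)
  have hi₃ : IntegrableOn (fun y => g (x₁ * y) * y ^ (-1 - a) - g (x₂ * y) * y ^ (-1 - a)
    + g (x₃ * y) * y ^ (-1 - a)) (Ioi 0) := hi₂.add (hi x₃)
  simp only [hsum, sub_mul, add_mul]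
  rw [integral_sub hi₃ (hi x₄), integral_add hi₂ (hi x₃), integral_sub (hi x₁) (hi x₂)]
  simp only [integral_odd_comp_mul hg, hval]
  ring

theorem intervalIntegrable_abs_rpow {r : ℝ} (hr : -1 < r) (p q : ℝ) :
    IntervalIntegrable (fun u : ℝ => |u| ^ r) volume p q := by
  have pos : ∀ q : ℝ, 0 ≤ q → IntervalIntegrable (fun u : ℝ => |u| ^ r) volume 0 q := by
    intro q hq
    refine (intervalIntegral.intervalIntegrable_rpow' hr).congr_ae ?_
    rw [uIoc_of_le hq]
    refine (ae_restrict_iff' measurableSet_Ioc).2 (.of_forall fun u hu => ?_)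
    simp only [abs_of_pos hu.1]
  have all : ∀ q : ℝ, IntervalIntegrable (fun u : ℝ => |u| ^ r) volume 0 q := by
    intro q
    rcases le_total 0 q with h | h
    · exact pos q h
    · have := IntervalIntegrable.iff_comp_neg (f := fun u : ℝ => |u| ^ r) (a := 0) (b := -q)
      simpa using this.1 (pos (-q) (by linarith))
  exact (all p).symm.trans (all q)

/-- `signPow a u / a` is a primitive of |u|^(a-1), valid across the singularity at 0 because `a >
0`. -/
theorem integral_abs_rpow {a : ℝ} (ha : 0 < a) (p q : ℝ) :
    ∫ u in p..q, |u| ^ (a - 1) = (signPow a q - signPow a p) / a := by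
  have pos : ∀ q : ℝ, 0 ≤ q → ∫ u in (0 : ℝ)..q, |u| ^ (a - 1) = signPow a q / a := by
    intro q hq
    have : ∫ u in (0 : ℝ)..q, |u| ^ (a - 1) = ∫ u in (0 : ℝ)..q, u ^ (a - 1) := by
      refine intervalIntegral.integral_congr fun u hu => ?_
      rw [uIcc_of_le hq] at hu
      simp only [abs_of_nonneg hu.1]
    rw [this, integral_rpow (Or.inl (by linarith)), sub_add_cancel, zero_rpow ha.ne', sub_zero]
    rcases hq.eq_or_lt with rfl | hq
    · simp [zero_rpow ha.ne']
    · rw [signPow_of_pos hq]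
  have all : ∀ q : ℝ, ∫ u in (0 : ℝ)..q, |u| ^ (a - 1) = signPow a q / a := by
    intro q
    rcases le_total 0 q with h | h
    · exact pos q h
    · have h1 := pos (-q) (by linarith)
      have h2 := intervalIntegral.integral_comp_neg (a := 0) (b := -q)
        (fun u : ℝ => |u| ^ (a - 1))
      simp only [abs_neg, neg_neg, neg_zero] at h2
      rw [intervalIntegral.integral_symm, ← h2, h1, signPow_neg, neg_div, neg_neg]
  have hi := fun p q => intervalIntegrable_abs_rpow (r := a - 1) (by linarith) p q
  rw [← intervalIntegral.integral_add_adjacent_intervals (hi p 0) (hi 0 q), all,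
    intervalIntegral.integral_symm, all]
  ring

/-! ### The one-dimensional identity between the two factors. -/

/-- One factor of the moving average kernel, with exponent `a - 1`. -/
noncomputable def maFactor (a t u : ℝ) : ℝ := |t - u| ^ (a - 1) - |u| ^ (a - 1)

/-- One factor of the harmonizable kernel. -/
noncomputable def harmFactor (a t x : ℝ) : ℂ :=
  (Complex.exp (Complex.I * (t : ℂ) * (x : ℂ)) - 1) / ((|x| ^ a : ℝ) : ℂ)

/-- The Fourier transform of the indicator of `(p, q]`. -/
noncomputable def intervalFourier (p q x : ℝ) : ℂ :=
  ∫ y in Ioc p q, Complex.exp (-(Complex.I * (y : ℂ) * (x : ℂ)))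

theorem intervalIntegrable_abs_sub_rpow {r : ℝ} (hr : -1 < r) (t p q : ℝ) :
    IntervalIntegrable (fun u : ℝ => |t - u| ^ r) volume p q := by
  simpa using (intervalIntegrable_abs_rpow hr (t - p) (t - q)).comp_sub_left t

theorem integrableOn_maFactor {a : ℝ} (ha : 0 < a) (t : ℝ) {p q : ℝ} (hpq : p ≤ q) :
    IntegrableOn (maFactor a t) (Ioc p q) := by
  have := (intervalIntegrable_abs_sub_rpow (r := a - 1) (by linarith) t p q).sub
    (intervalIntegrable_abs_rpow (r := a - 1) (by linarith) p q)
  rwa [intervalIntegrable_iff_integrableOn_Ioc_of_le hpq] at this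

theorem integral_maFactor {a : ℝ} (ha : 0 < a) (t : ℝ) {p q : ℝ} (hpq : p ≤ q) :
    ∫ u in Ioc p q, maFactor a t u
      = (signPow a (t - p) - signPow a (t - q) + signPow a p - signPow a q) / a := by
  rw [← intervalIntegral.integral_of_le hpq]
  simp only [maFactor]
  rw [intervalIntegral.integral_sub
    (intervalIntegrable_abs_sub_rpow (by linarith) t p q)
    (intervalIntegrable_abs_rpow (by linarith) p q), integral_abs_rpow ha,
    intervalIntegral.integral_comp_sub_left (fun u : ℝ => |u| ^ (a - 1)), integral_abs_rpow ha]
  ring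

theorem intervalFourier_eq {p q x : ℝ} (hpq : p ≤ q) (hx : x ≠ 0) :
    intervalFourier p q x = (Complex.exp (-(Complex.I * p * x)) - Complex.exp (-(Complex.I * q * x)))
      / (Complex.I * x) := by
  have hc : -(Complex.I * (x : ℂ)) ≠ 0 := by simpa using hx
  rw [intervalFourier, ← intervalIntegral.integral_of_le hpq]
  have := integral_exp_mul_complex (a := p) (b := q) hc
  simp only [neg_mul, mul_right_comm] at this ⊢
  rw [this, div_neg, ← neg_div]
  congr 1
  ring

theorem norm_exp_neg_I_mul (y x : ℝ) : ‖Complex.exp (-(Complex.I * (y : ℂ) * (x : ℂ)))‖ = 1 := by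
  rw [show -(Complex.I * (y : ℂ) * (x : ℂ)) = ((-(y * x) : ℝ) : ℂ) * Complex.I by push_cast; ring,
    Complex.norm_exp_ofReal_mul_I]

theorem norm_intervalFourier_le {p q : ℝ} (hpq : p ≤ q) (x : ℝ) :
    ‖intervalFourier p q x‖ ≤ q - p := by
  rw [intervalFourier]
  refine (norm_setIntegral_le_of_norm_le_const (C := 1) (by simp)
    fun y _ => (norm_exp_neg_I_mul y x).le).trans ?_
  simp [hpq]

theorem norm_intervalFourier_le_div {p q x : ℝ} (hpq : p ≤ q) (hx : x ≠ 0) :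
    ‖intervalFourier p q x‖ ≤ 2 / |x| := by
  rw [intervalFourier_eq hpq hx, norm_div, norm_mul, Complex.norm_I, one_mul, Complex.norm_real,
    Real.norm_eq_abs]
  gcongr
  refine (norm_sub_le _ _).trans ?_
  rw [norm_exp_neg_I_mul, norm_exp_neg_I_mul]; norm_num

theorem continuous_intervalFourier (p q : ℝ) : Continuous (intervalFourier p q) := by
  refine continuous_of_dominated (bound := fun _ => 1) ?_ ?_ ?_ ?_
  · intro x
    exact Continuous.aestronglyMeasurable (by fun_prop)
  · exact fun x => .of_forall fun y => (norm_exp_neg_I_mul y x).le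
  · exact integrable_const _
  · exact .of_forall fun y => by fun_prop

theorem measurable_harmFactor (a t : ℝ) : Measurable (harmFactor a t) := by
  unfold harmFactor
  refine Measurable.div (by fun_prop) (Complex.measurable_ofReal.comp (by fun_prop))

theorem norm_harmFactor_le (a t x : ℝ) :
    ‖harmFactor a t x‖ ≤ 2 / |x| ^ a := by
  rw [harmFactor, norm_div, Complex.norm_real, norm_of_nonneg (by positivity)]
  gcongr
  refine (norm_sub_le _ _).trans ?_
  rw [show Complex.I * (t : ℂ) * (x : ℂ) = ((t * x : ℝ) : ℂ) * Complex.I by push_cast; ring,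
    Complex.norm_exp_ofReal_mul_I]
  norm_num

theorem norm_harmFactor_le' (a t x : ℝ) :
    ‖harmFactor a t x‖ ≤ |t| * |x| / |x| ^ a := by
  rw [harmFactor, norm_div, Complex.norm_real, norm_of_nonneg (by positivity : 0 ≤ |x| ^ a)]
  gcongr
  rw [mul_assoc, ← Complex.ofReal_mul, ← abs_mul]
  exact Real.norm_exp_I_mul_ofReal_sub_one_le

theorem integrable_of_norm_le {E : Type*} [NormedAddCommGroup E] {F : ℝ → E}
    (hF : AEStronglyMeasurable F volume) {A B r s : ℝ} (hr : -1 < r)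
    (hs : s < -1) (h0 : ∀ x, x ≠ 0 → ‖F x‖ ≤ A * |x| ^ r)
    (h1 : ∀ x, x ≠ 0 → ‖F x‖ ≤ B * |x| ^ s) : Integrable F := by
  have hm := (Measure.measurePreserving_neg (volume : Measure ℝ))
  have h2 : IntegrableOn F (Ioi 0) := integrableOn_Ioi_of_norm_le hF.restrict hr hs
    (fun x hx => by simpa [abs_of_pos hx] using h0 x hx.ne')
    (fun x hx => by simpa [abs_of_pos hx] using h1 x hx.ne')
  have h3 : IntegrableOn (fun x => F (-x)) (Ioi 0) :=
    integrableOn_Ioi_of_norm_le (hF.comp_measurePreserving hm).restrict hr hs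
    (fun x hx => by simpa [abs_of_pos hx] using h0 (-x) (by simpa using hx.ne'))
    (fun x hx => by simpa [abs_of_pos hx] using h1 (-x) (by simpa using hx.ne'))
  have h4 : IntegrableOn F (Iio 0) := by
    have := (hm.integrableOn_comp_preimage (Homeomorph.neg ℝ).measurableEmbedding
      (f := F) (s := Iio 0))
    simpa [Function.comp_def, h3] using this
  rw [← integrableOn_univ, ← Iic_union_Ioi (a := (0 : ℝ)), integrableOn_union,
    integrableOn_Iic_iff_integrableOn_Iio]
  exact ⟨h4, h2⟩

/-- The squared norm is O(|x|^(2-2a)) at 0 and O(|x|^(-2a)) at infinity; the bounds on `a` are what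
these exponents need. -/
theorem memLp_harmFactor {a : ℝ} (h1 : 1 / 2 < a) (h2 : a < 3 / 2) (t : ℝ) :
    MemLp (harmFactor a t) 2 volume := by
  rw [memLp_two_iff_integrable_sq_norm (measurable_harmFactor a t).aestronglyMeasurable]
  refine integrable_of_norm_le (A := |t| ^ 2) (B := 4) (r := 2 - 2 * a) (s := -(2 * a))
    ((measurable_harmFactor a t).norm.pow_const 2).aestronglyMeasurable (by linarith)
    (by linarith) ?_ ?_
  · intro x hx
    have hx' := abs_pos.2 hx
    rw [norm_pow, norm_norm]
    calc _ ≤ (|t| * |x| / |x| ^ a) ^ 2 := by gcongr; exact norm_harmFactor_le' a t x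
      _ = _ := by
        rw [rpow_sub hx', mul_comm 2 a, rpow_mul hx'.le, div_pow, mul_pow, mul_div_assoc]
        norm_cast
  · intro x hx
    have hx' := abs_pos.2 hx
    rw [norm_pow, norm_norm]
    calc _ ≤ (2 / |x| ^ a) ^ 2 := by gcongr; exact norm_harmFactor_le a t x
      _ = _ := by
        rw [rpow_neg hx'.le, mul_comm 2 a, rpow_mul hx'.le, div_pow, div_eq_mul_inv]
        norm_cast

/-- The decay 2/|x| of the interval's transform supplies integrability at infinity for every `a >
0`; near 0 the bound |t| |x|^(1-a) suffices for `a < 2`. -/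
theorem integrable_harmFactor_mul {a : ℝ} (h1 : 0 < a) (h2 : a < 2) (t : ℝ) {p q : ℝ}
    (hpq : p ≤ q) : Integrable (fun x => harmFactor a t x * intervalFourier p q x) := by
  refine integrable_of_norm_le (A := |t| * (q - p)) (B := 4) (r := 1 - a) (s := -1 - a)
    ((measurable_harmFactor a t).mul (continuous_intervalFourier p q).measurable).aestronglyMeasurable
    (by linarith) (by linarith) ?_ ?_
  · intro x hx
    have hx' := abs_pos.2 hx
    rw [norm_mul]
    calc _ ≤ (|t| * |x| / |x| ^ a) * (q - p) := by
          gcongr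
          · exact norm_harmFactor_le' a t x
          · exact norm_intervalFourier_le hpq x
      _ = _ := by rw [rpow_sub hx', rpow_one]; ring
  · intro x hx
    have hx' := abs_pos.2 hx
    rw [norm_mul]
    calc _ ≤ (2 / |x| ^ a) * (2 / |x|) := by
          gcongr
          · exact norm_harmFactor_le a t x
          · exact norm_intervalFourier_le_div hpq hx
      _ = _ := by rw [rpow_sub hx', rpow_neg_one]; field_simp; norm_num

/-- The ratio of the moving average kernel and the Fourier transform of the harmonizable kernel. -/
noncomputable def ratio (a : ℝ) : ℝ := Gamma a * cos (π * a / 2) / π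

/-- The values of the integrand at x and -x are conjugate, and their sum is 2 x^(-1-a) times a
combination of four sines with frequencies t-p, t-q, p, q. Their alternating sum is zero, as
`integral_sin_sum_mul_rpow` requires. -/
theorem integral_harmFactor_mul {a : ℝ} (h0 : 0 < a) (h1 : a ≠ 1) (h2 : a < 2) (t : ℝ) {p q : ℝ}
    (hpq : p ≤ q) :
    ∫ x, harmFactor a t x * intervalFourier p q x
      = ((2 * (sinConst a * (signPow a (t - p) - signPow a (t - q) + signPow a p - signPow a q)) :
        ℝ) : ℂ) := by
  have hi := integrable_harmFactor_mul h0 h2 t hpq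
  rw [← intervalIntegral.integral_Iic_add_Ioi hi.integrableOn hi.integrableOn (b := (0 : ℝ)),
    ← neg_zero, ← integral_comp_neg_Ioi, neg_zero, ← integral_add hi.comp_neg.integrableOn
    hi.integrableOn, ← integral_sin_sum_mul_rpow h0 h1 (by linarith) (by ring), ← integral_const_mul,
    ← integral_complex_ofReal]
  refine setIntegral_congr_fun measurableSet_Ioi fun x hx => ?_
  have hx0 : (0 : ℝ) < x := hx
  simp only [harmFactor]
  rw [intervalFourier_eq hpq hx0.ne', intervalFourier_eq hpq (neg_ne_zero.2 hx0.ne'),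
    abs_neg, abs_of_pos hx0, rpow_sub hx0, rpow_neg_one]
  have hxa : ((x ^ a : ℝ) : ℂ) ≠ 0 := by exact_mod_cast (rpow_pos_of_pos hx0 a).ne'
  have hxc : (x : ℂ) ≠ 0 := by exact_mod_cast hx0.ne'
  push_cast
  have hsin : ∀ z : ℂ, Complex.sin z
      = (Complex.exp (Complex.I * z) - Complex.exp (-(Complex.I * z))) / (2 * Complex.I) := by
    intro z
    rw [Complex.sin, mul_comm Complex.I z, ← neg_mul]
    field_simp
    rw [Complex.I_sq]; ring
  have hsub : ∀ u v : ℂ, Complex.exp (Complex.I * ((u - v) * x))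
      = Complex.exp (Complex.I * u * x) * Complex.exp (-(Complex.I * v * x)) := by
    intro u v; rw [← Complex.exp_add]; congr 1; ring
  have hsub' : ∀ u v : ℂ, Complex.exp (-(Complex.I * ((u - v) * x)))
      = Complex.exp (-(Complex.I * u * x)) * Complex.exp (Complex.I * v * x) := by
    intro u v; rw [← Complex.exp_add]; congr 1; ring
  simp only [hsin, hsub, hsub']
  simp only [mul_neg, neg_neg, ← mul_assoc]
  field_simp
  ring

theorem cos_pi_mul_div_two_ne_zero {a : ℝ} (h0 : 0 < a) (h1 : a ≠ 1) (h2 : a < 2) :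
    cos (π * a / 2) ≠ 0 := by
  rw [Ne, cos_eq_zero_iff]
  rintro ⟨k, hk⟩
  have : a = 2 * k + 1 := by field_simp at hk; linarith
  have hk0 : (-1 : ℝ) < k := by linarith
  have hk1 : (k : ℝ) < 1 := by linarith
  have : k = 0 := by norm_cast at hk0 hk1; omega
  simp_all

theorem ratio_mul_integral_harmFactor {a : ℝ} (h0 : 0 < a) (h2 : a < 2) (t : ℝ) {p q : ℝ}
    (hpq : p ≤ q) :
    (ratio a : ℂ) * ∫ x, harmFactor a t x * intervalFourier p q x
      = ((∫ u in Ioc p q, maFactor a t u : ℝ) : ℂ) := by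
  -- At `a = 1` both sides vanish: the exponent a - 1 is 0, so `maFactor` is identically 0, and
  -- `ratio 1` contains cos(π/2) = 0.
  by_cases h1 : a = 1
  · subst h1
    simp [maFactor, ratio]
  · rw [integral_harmFactor_mul h0 h1 h2 t hpq, integral_maFactor h0 t hpq]
    norm_cast
    have hc := cos_pi_mul_div_two_ne_zero h0 h1 h2
    have hG : Gamma a ≠ 0 := (Gamma_pos_of_pos h0).ne'
    rw [ratio, sinConst, add_comm 1 a, Gamma_add_one h0.ne']
    field_simp

/-! ### The L² Fourier transform integrated over sets of finite measure. -/

section FourierInv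

variable {E : Type*} [NormedAddCommGroup E] [InnerProductSpace ℝ E] [FiniteDimensional ℝ E]
  [MeasurableSpace E] [BorelSpace E]

/-- Fubini with a symmetric kernel: the form `-innerₗ E` equals its flip. -/
theorem integral_fourierInv_mul_eq {f g : E → ℂ} (hf : Integrable f) (hg : Integrable g) :
    ∫ x, 𝓕⁻ f x * g x = ∫ x, f x * 𝓕⁻ g x := by
  have hc : Continuous fun p : E × E => (-innerₗ E) p.1 p.2 := by
    change Continuous fun p : E × E => -inner ℝ p.1 p.2
    fun_prop
  have h := VectorFourier.integral_fourierIntegral_smul_eq_flip (L := -innerₗ E)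
    Real.continuous_fourierChar hc hf hg
  have hflip : (-innerₗ E).flip = -innerₗ E := by
    ext x y; simp [real_inner_comm]
  rw [hflip] at h
  exact h

theorem continuous_fourierInv {f : E → ℂ} (hf : Integrable f) : Continuous (𝓕⁻ f) := by
  have hc : Continuous fun p : E × E => (-innerₗ E) p.1 p.2 := by
    change Continuous fun p : E × E => -inner ℝ p.1 p.2
    fun_prop
  exact VectorFourier.fourierIntegral_continuous (L := -innerₗ E) Real.continuous_fourierChar hc hf

/-- On `L¹ ∩ L²`, the `L²` inverse Fourier transform is given by the integral. -/
theorem fourierInv_toLp_ae_eq {g : E → ℂ} (h1 : Integrable g) (h2 : MemLp g 2 volume) :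
    (𝓕⁻ (h2.toLp g) : Lp (α := E) ℂ 2 volume) =ᵐ[volume] 𝓕⁻ g := by
  refine ae_eq_of_integral_contDiff_smul_eq ?_ (continuous_fourierInv h1).locallyIntegrable ?_
  · exact (Lp.memLp _).locallyIntegrable (by norm_num)
  intro ψ hψ hsupp
  have hsupp' : HasCompactSupport (fun x => (ψ x : ℂ)) :=
    hsupp.comp_left (g := fun r : ℝ => (r : ℂ)) Complex.ofReal_zero
  have hψ' : ContDiff ℝ (⊤ : ℕ∞) (fun x => (ψ x : ℂ)) := Complex.ofRealCLM.contDiff.comp hψ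
  let φ : SchwartzMap E ℂ := hsupp'.toSchwartzMap hψ'
  have hφ : ∀ x, φ x = (ψ x : ℂ) := fun _ => rfl
  -- The L² transform agrees with the distributional one, which is defined by duality, so testing
  -- against φ moves the transform onto φ.
  have key := DFunLike.congr_fun (Lp.fourierInv_toTemperedDistribution_eq (h2.toLp g)) φ
  rw [TemperedDistribution.fourierInv_apply, Lp.toTemperedDistribution_apply,
    Lp.toTemperedDistribution_apply] at key
  calc ∫ x, ψ x • (𝓕⁻ (h2.toLp g) : Lp (α := E) ℂ 2 volume) x
      = ∫ x, φ x • (𝓕⁻ (h2.toLp g) : Lp (α := E) ℂ 2 volume) x := by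
        simp only [hφ, Complex.real_smul, smul_eq_mul]
    _ = ∫ x, 𝓕⁻ (φ : E → ℂ) x * g x := by
        rw [← key]
        refine integral_congr_ae ?_
        filter_upwards [h2.coeFn_toLp] with x hx
        rw [hx, SchwartzMap.fourierInv_coe, smul_eq_mul]
    _ = ∫ x, φ x * 𝓕⁻ g x := integral_fourierInv_mul_eq φ.integrable h1
    _ = ∫ x, ψ x • 𝓕⁻ g x := by simp only [hφ, Complex.real_smul]

/-- Integrals of the `L²` Fourier transform over sets of finite measure. -/
theorem setIntegral_fourier_eq (f : Lp (α := E) ℂ 2 volume) {s : Set E} (hs : MeasurableSet s)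
    (hs' : volume s ≠ ∞) :
    ∫ x in s, (𝓕 f : Lp (α := E) ℂ 2 volume) x
      = ∫ ξ, f ξ * ∫ x in s, Complex.exp (((-(2 * π * inner ℝ x ξ) : ℝ) : ℂ) * Complex.I) := by
  have h1 : Integrable (s.indicator (fun _ => (1 : ℂ))) :=
    (integrable_indicator_iff hs).2 (integrableOn_const hs')
  have h2 : MemLp (s.indicator (fun _ => (1 : ℂ))) 2 volume :=
    memLp_indicator_const 2 hs 1 (Or.inr hs')
  -- Parseval for the inverse transform of the indicator of s and f: the set integral is ⟨1_s, 𝓕 f⟩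
  -- = ⟨𝓕⁻ 1_s, f⟩, and 𝓕⁻ 1_s is an honest integral.
  have h3 := Lp.inner_fourier_eq (𝓕⁻ (h2.toLp _)) f
  rw [FourierTransform.fourier_fourierInv_eq, L2.inner_def, L2.inner_def] at h3
  calc ∫ x in s, (𝓕 f : Lp (α := E) ℂ 2 volume) x
      = ∫ x, inner ℂ ((h2.toLp _ : Lp (α := E) ℂ 2 volume) x) ((𝓕 f : Lp (α := E) ℂ 2 volume) x) := by
        rw [← integral_indicator hs]
        refine integral_congr_ae ?_
        filter_upwards [h2.coeFn_toLp] with x hx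
        rw [hx]
        by_cases hxs : x ∈ s <;> simp [hxs]
    _ = _ := by
        rw [h3]
        refine integral_congr_ae ?_
        filter_upwards [fourierInv_toLp_ae_eq h1 h2] with ξ hξ
        rw [hξ, RCLike.inner_apply, Real.fourierInv_eq', ← integral_conj, ← integral_indicator hs]
        congr 1
        refine integral_congr_ae (.of_forall fun x => ?_)
        by_cases hxs : x ∈ s
        · simp [hxs, ← Complex.exp_conj, Complex.conj_ofNat]
        · simp [hxs]

end FourierInv

/-! ### Boxes: product integrals, and boxes determine a function. -/

/-- The half-open box `∏ (pᵢ, qᵢ]` in `ℝ^N`. -/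
def box {N : ℕ} (p q : Fin N → ℝ) : Set (Space N) := {x | ∀ i, x i ∈ Ioc (p i) (q i)}

theorem box_eq_preimage {N : ℕ} (p q : Fin N → ℝ) :
    box p q = (WithLp.ofLp : Space N → Fin N → ℝ) ⁻¹' (univ.pi fun i => Ioc (p i) (q i)) := by
  ext x; simp [box]

theorem measurePreserving_ofLp (N : ℕ) :
    MeasurePreserving (WithLp.ofLp : Space N → Fin N → ℝ) volume volume :=
  PiLp.volume_preserving_ofLp (Fin N)

theorem measurableEmbedding_ofLp (N : ℕ) :
    MeasurableEmbedding (WithLp.ofLp : Space N → Fin N → ℝ) :=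
  (MeasurableEquiv.toLp 2 (Fin N → ℝ)).symm.measurableEmbedding

theorem measurableSet_box {N : ℕ} (p q : Fin N → ℝ) : MeasurableSet (box p q) := by
  rw [box_eq_preimage]
  exact (measurableEmbedding_ofLp N).measurable
    (MeasurableSet.univ_pi fun i => measurableSet_Ioc)

theorem volume_box_ne_top {N : ℕ} (p q : Fin N → ℝ) : volume (box p q) ≠ ∞ := by
  rw [box_eq_preimage, (measurePreserving_ofLp N).measure_preimage_emb
    (measurableEmbedding_ofLp N), Real.volume_pi_Ioc]
  exact ENNReal.prod_ne_top fun i _ => ENNReal.ofReal_ne_top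

theorem integral_prod_eq {N : ℕ} (f : Fin N → ℝ → ℂ) :
    ∫ x : Space N, ∏ i, f i (x i) = ∏ i, ∫ y, f i y := by
  rw [← integral_fintype_prod_volume_eq_prod]
  exact (measurePreserving_ofLp N).integral_comp (measurableEmbedding_ofLp N)
    (fun y : Fin N → ℝ => ∏ i, f i (y i))

theorem restrict_pi_Ioc {N : ℕ} (p q : Fin N → ℝ) :
    (volume : Measure (Fin N → ℝ)).restrict (univ.pi fun i => Ioc (p i) (q i))
      = Measure.pi fun i => volume.restrict (Ioc (p i) (q i)) := by
  rw [volume_pi, Measure.restrict_pi_pi]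

theorem setIntegral_box_prod {N : ℕ} (f : Fin N → ℝ → ℂ) (p q : Fin N → ℝ) :
    ∫ x in box p q, ∏ i, f i (x i) = ∏ i, ∫ y in Ioc (p i) (q i), f i y := by
  rw [← integral_fintype_prod_eq_prod, ← restrict_pi_Ioc, box_eq_preimage]
  exact (measurePreserving_ofLp N).setIntegral_preimage_emb (measurableEmbedding_ofLp N)
    (fun y : Fin N → ℝ => ∏ i, f i (y i)) _

theorem integrableOn_box_prod {N : ℕ} {f : Fin N → ℝ → ℂ} {p q : Fin N → ℝ}
    (hf : ∀ i, IntegrableOn (f i) (Ioc (p i) (q i))) :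
    IntegrableOn (fun x : Space N => ∏ i, f i (x i)) (box p q) := by
  have h := Integrable.fintype_prod hf
  rw [← restrict_pi_Ioc] at h
  rw [box_eq_preimage]
  exact ((measurePreserving_ofLp N).integrableOn_comp_preimage (measurableEmbedding_ofLp N)).2 h

theorem memLp_prod {N : ℕ} {f : Fin N → ℝ → ℂ} (hf : ∀ i, Measurable (f i))
    (hf2 : ∀ i, MemLp (f i) 2 volume) :
    MemLp (fun x : Space N => ∏ i, f i (x i)) 2 volume := by
  have hm : Measurable (fun x : Space N => ∏ i, f i (x i)) := by
    refine Finset.measurable_prod _ fun i _ => (hf i).comp ?_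
    exact (measurable_pi_apply i).comp (measurableEmbedding_ofLp N).measurable
  rw [memLp_two_iff_integrable_sq_norm hm.aestronglyMeasurable]
  have h := Integrable.fintype_prod (f := fun i y => ‖f i y‖ ^ 2)
    fun i => (memLp_two_iff_integrable_sq_norm (hf i).aestronglyMeasurable).1 (hf2 i)
  have h' := ((measurePreserving_ofLp N).integrable_comp_emb (measurableEmbedding_ofLp N)).2 h
  simpa [Function.comp_def, norm_prod, Finset.prod_pow] using h'

/-- Integrals of `f̂` over boxes. -/
theorem setIntegral_box_fourierL2 {N : ℕ} (f : L2 N) (p q : Fin N → ℝ) :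
    ∫ x in box p q, fourierL2 f x = ∫ ξ, f ξ * ∏ i, intervalFourier (p i) (q i) (ξ i) := by
  have hc : (0 : ℝ) < (2 * π)⁻¹ := by positivity
  have hms : MeasurableSet ((2 * π)⁻¹ • box p q) :=
    (measurableSet_box p q).const_smul₀ _
  have hvs : volume ((2 * π)⁻¹ • box p q) ≠ ∞ := by
    rw [Measure.addHaar_smul]
    exact ENNReal.mul_ne_top ENNReal.ofReal_ne_top (volume_box_ne_top p q)
  -- `K` is the Jacobian (2π)^N. Rescaling the box by 1/(2π) turns the kernel e^(-2πi⟨x,ξ⟩) into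
  -- e^(-i⟨x,ξ⟩).
  set K : ℝ := ((2 * π)⁻¹ ^ Module.finrank ℝ (Space N))⁻¹ with hK
  have hin : ∀ ξ : Space N, K • ∫ x in (2 * π)⁻¹ • box p q,
      Complex.exp (((-(2 * π * inner ℝ x ξ) : ℝ) : ℂ) * Complex.I)
      = ∏ i, intervalFourier (p i) (q i) (ξ i) := by
    intro ξ
    rw [hK, ← Measure.setIntegral_comp_smul_of_pos volume (fun x : Space N =>
      Complex.exp (((-(2 * π * inner ℝ x ξ) : ℝ) : ℂ) * Complex.I)) _ hc]
    simp only [intervalFourier]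
    rw [← setIntegral_box_prod (fun i y => Complex.exp (-(Complex.I * (y : ℂ) * (ξ i : ℂ))))]
    refine integral_congr_ae (.of_forall fun x => ?_)
    simp only
    rw [← Complex.exp_sum, real_inner_smul_left, ← mul_assoc, mul_inv_cancel₀ (by positivity),
      one_mul, PiLp.inner_apply]
    congr 1
    push_cast
    rw [neg_mul, Finset.sum_mul, ← Finset.sum_neg_distrib]
    refine Finset.sum_congr rfl fun i _ => ?_
    simp
    ring
  calc ∫ x in box p q, fourierL2 f x
      = ∫ x in box p q, (𝓕 f : L2 N) ((2 * π)⁻¹ • x) :=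
        integral_congr_ae (ae_restrict_of_ae (MemLp.coeFn_toLp _))
    _ = K • ∫ x in (2 * π)⁻¹ • box p q, (𝓕 f : L2 N) x :=
        Measure.setIntegral_comp_smul_of_pos volume _ _ hc
    _ = _ := by
        rw [setIntegral_fourier_eq f hms hvs, ← integral_smul]
        refine integral_congr_ae (.of_forall fun ξ => ?_)
        simp only
        rw [← hin, mul_smul_comm]

theorem isCountablySpanning_Ioc :
    IsCountablySpanning {S : Set ℝ | ∃ l u, l < u ∧ Ioc l u = S} := by
  refine ⟨fun n : ℕ => Ioc (-(n + 1 : ℝ)) (n + 1),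
    fun n => ⟨_, _, by linarith [n.cast_nonneg (α := ℝ)], rfl⟩, ?_⟩
  refine eq_univ_of_forall fun x => mem_iUnion.2 ?_
  obtain ⟨n, hn⟩ := exists_nat_gt |x|
  refine ⟨n, ?_, ?_⟩ <;> linarith [abs_lt.1 hn]

/-- A function on `ℝ^N` with vanishing integrals over all half-open boxes vanishes a.e. -/
theorem ae_eq_zero_of_setIntegral_pi_Ioc {N : ℕ} {h : (Fin N → ℝ) → ℂ}
    (hi : ∀ p q : Fin N → ℝ, IntegrableOn h (univ.pi fun i => Ioc (p i) (q i)))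
    (h0 : ∀ p q : Fin N → ℝ, ∫ x in univ.pi fun i => Ioc (p i) (q i), h x = 0) :
    h =ᵐ[volume] 0 := by
  let B : ℕ → Set (Fin N → ℝ) := fun n => univ.pi fun _ => Ioc (-(n : ℝ)) n
  have hB : ∀ n, MeasurableSet (B n) := fun n => MeasurableSet.univ_pi fun _ => measurableSet_Ioc
  have hU : ⋃ n, B n = univ := by
    refine eq_univ_of_forall fun x => mem_iUnion.2 ?_
    obtain ⟨n, hn⟩ := exists_nat_gt ‖x‖
    refine ⟨n, fun i _ => ?_⟩
    have := (norm_le_pi_norm x i).trans_lt hn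
    rw [Real.norm_eq_abs, abs_lt] at this
    exact ⟨this.1, this.2.le⟩
  rw [← Measure.restrict_univ (μ := volume), ← hU, EventuallyEq, ae_restrict_iUnion_iff]
  intro n
  have hBi : Integrable h (volume.restrict (B n)) := hi _ _
  refine hBi.ae_eq_zero_of_forall_setIntegral_eq_zero fun s hs hfin => ?_
  clear hfin
  have hgen : MeasurableSpace.pi (X := fun _ : Fin N => ℝ) = MeasurableSpace.generateFrom
      (pi univ '' pi univ fun _ => {S : Set ℝ | ∃ l u, l < u ∧ Ioc l u = S}) := by
    refine (generateFrom_eq_pi (fun _ => ?_) fun _ => isCountablySpanning_Ioc).symm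
    rw [← borel_eq_generateFrom_Ioc, BorelSpace.measurable_eq (α := ℝ)]
  -- π-λ argument inside the cube `B n`: a generating box meets the cube in another, possibly empty,
  -- box, and complements work because the cube itself is a box with zero integral.
  induction s, hs using MeasurableSpace.induction_on_inter hgen with
  | h_inter => exact IsPiSystem.pi fun _ => isPiSystem_Ioc id id
  | empty => simp
  | basic t ht =>
    obtain ⟨C, hC, rfl⟩ := ht
    choose l u _ hlu using fun i => hC i (mem_univ i)
    have : pi univ C ∩ B n = univ.pi fun i => Ioc (max (l i) (-n)) (min (u i) n) := by
      rw [← pi_inter_distrib]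
      congr 1; ext1 i
      rw [← hlu, Ioc_inter_Ioc]
    rw [Measure.restrict_restrict (MeasurableSet.univ_pi fun i => hlu i ▸ measurableSet_Ioc), this]
    exact h0 _ _
  | compl t ht ih =>
    have h1 := integral_add_compl ht hBi
    rw [ih, zero_add] at h1
    rw [h1]
    exact h0 _ _
  | iUnion f hd hf ih =>
    rw [integral_iUnion hf hd hBi.integrableOn]
    simp [ih]

theorem ae_eq_of_setIntegral_box {N : ℕ} {f g : Space N → ℂ}
    (hf : ∀ p q, IntegrableOn f (box p q)) (hg : ∀ p q, IntegrableOn g (box p q))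
    (h : ∀ p q, ∫ x in box p q, f x = ∫ x in box p q, g x) : f =ᵐ[volume] g := by
  have hmp := measurePreserving_ofLp N
  have hme := measurableEmbedding_ofLp N
  have hz : (fun y : Fin N → ℝ => (f - g) (WithLp.toLp 2 y)) =ᵐ[volume] 0 := by
    refine ae_eq_zero_of_setIntegral_pi_Ioc (fun p q => ?_) (fun p q => ?_)
    · rw [← hmp.integrableOn_comp_preimage hme, ← box_eq_preimage]
      exact (hf p q).sub (hg p q)
    · rw [← hmp.setIntegral_preimage_emb hme, ← box_eq_preimage]
      have := integral_sub (hf p q) (hg p q)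
      rw [h p q, sub_self] at this
      exact this
  filter_upwards [hmp.quasiMeasurePreserving.ae hz] with x hx
  exact sub_eq_zero.1 hx

/-! ### The kernels on ℝ^N and the constant λ. -/

section Kernels

variable {N : ℕ} (H : Index N → Fin N → ℝ)

theorem maKernel_eq (t : Index N) (u : Space N) :
    maKernel H t u = ∏ i, ((maFactor (H t i + 1 / 2) (t i) (u i) : ℝ) : ℂ) := by
  refine Finset.prod_congr rfl fun i _ => ?_
  rw [maFactor, show H t i + 1 / 2 - 1 = H t i - 1 / 2 by ring]

variable {H}

theorem memLp_harmKernel (hH : ∀ t m, H t m ∈ Ioo (0 : ℝ) 1) (t : Index N) :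
    MemLp (harmKernel H t) 2 volume := by
  refine memLp_prod (f := fun m => harmFactor (H t m + 1 / 2) (t m))
    (fun m => measurable_harmFactor _ _) fun m => memLp_harmFactor ?_ ?_ _
  · linarith [(hH t m).1]
  · linarith [(hH t m).2]

/-- The moving average kernel is a multiple of the Fourier transform of the harmonizable one. -/
theorem maKernel_ae_eq (hH : ∀ t m, H t m ∈ Ioo (0 : ℝ) 1) (t : Index N) :
    maKernel H t =ᵐ[volume] fun u => ((∏ m, ratio (H t m + 1 / 2) : ℝ) : ℂ) *
      fourierL2 ((memLp_harmKernel hH t).toLp _) u := by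
  set φ : L2 N := (memLp_harmKernel hH t).toLp _ with hφ
  have hpos : ∀ m, 0 < H t m + 1 / 2 := fun m => by linarith [(hH t m).1]
  have hlt : ∀ m, H t m + 1 / 2 < 2 := fun m => by linarith [(hH t m).2]
  have hloc : LocallyIntegrable (fourierL2 φ) volume :=
    (Lp.memLp (fourierL2 φ)).locallyIntegrable (by norm_num)
  refine ae_eq_of_setIntegral_box (fun p q => ?_) (fun p q => ?_) (fun p q => ?_)
  · rw [funext (maKernel_eq H t)]
    refine integrableOn_box_prod (f := fun i y => ((maFactor (H t i + 1 / 2) (t i) y : ℝ) : ℂ))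
      fun i => ?_
    rcases le_total (p i) (q i) with h | h
    · exact (integrableOn_maFactor (hpos i) (t i) h).ofReal
    · simp [h]
  · refine Integrable.const_mul ?_ _
    have : IsFiniteMeasure ((volume : Measure (Space N)).restrict (box p q)) :=
      ⟨by simpa using (volume_box_ne_top p q).lt_top⟩
    exact ((Lp.memLp (fourierL2 φ)).restrict _).integrable (by norm_num)
  · rw [integral_const_mul, setIntegral_box_fourierL2]
    have h1 : ∫ ξ, φ ξ * ∏ i, intervalFourier (p i) (q i) (ξ i)
        = ∏ i, ∫ y, harmFactor (H t i + 1 / 2) (t i) y * intervalFourier (p i) (q i) y := by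
      rw [← integral_prod_eq]
      refine integral_congr_ae ?_
      filter_upwards [(memLp_harmKernel hH t).coeFn_toLp] with ξ hξ
      rw [hφ, hξ, Finset.prod_mul_distrib]
      rfl
    simp only [maKernel_eq]
    rw [h1, setIntegral_box_prod (fun i y => ((maFactor (H t i + 1 / 2) (t i) y : ℝ) : ℂ)),
      Complex.ofReal_prod, ← Finset.prod_mul_distrib]
    refine Finset.prod_congr rfl fun i _ => ?_
    -- When `q i ≤ p i` the interval is empty and both factors are 0.
    rcases le_total (p i) (q i) with h | h
    · rw [ratio_mul_integral_harmFactor (hpos i) (hlt i) (t i) h, integral_complex_ofReal]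
    · simp [intervalFourier, h]

/-- Square integrability is inherited from the L² Fourier transform, so the singularities and tails
of the kernel need no estimate. -/
theorem memLp_maKernel (hH : ∀ t m, H t m ∈ Ioo (0 : ℝ) 1) (t : Index N) :
    MemLp (maKernel H t) 2 volume :=
  (memLp_congr_ae (maKernel_ae_eq hH t)).2 ((Lp.memLp _).const_mul _)

theorem toLp_maKernel_eq (hH : ∀ t m, H t m ∈ Ioo (0 : ℝ) 1) (t : Index N) :
    (memLp_maKernel hH t).toLp (maKernel H t)
      = ((∏ m, ratio (H t m + 1 / 2) : ℝ) : ℂ) •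
        fourierL2 ((memLp_harmKernel hH t).toLp (harmKernel H t)) := by
  refine Lp.ext ?_
  filter_upwards [(memLp_maKernel hH t).coeFn_toLp, maKernel_ae_eq hH t, Lp.coeFn_smul
    ((∏ m, ratio (H t m + 1 / 2) : ℝ) : ℂ)
    (fourierL2 ((memLp_harmKernel hH t).toLp (harmKernel H t)))] with u h1 h2 h3
  rw [h1, h2, h3, Pi.smul_apply, smul_eq_mul]

end Kernels

theorem ratio_ne_zero {a : ℝ} (h0 : 0 < a) (h1 : a ≠ 1) (h2 : a < 2) : ratio a ≠ 0 :=
  div_ne_zero (mul_ne_zero (Gamma_pos_of_pos h0).ne' (cos_pi_mul_div_two_ne_zero h0 h1 h2)) pi_ne_zero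

theorem continuousAt_ratio {a : ℝ} (h0 : 0 < a) : ContinuousAt ratio a := by
  have hG : ContinuousAt Gamma a := (differentiableAt_Gamma fun m => by
    have : (0 : ℝ) ≤ m := m.cast_nonneg
    linarith).continuousAt
  exact (hG.mul (by fun_prop)).div_const π

/-! ### Homogeneity of W and the pointwise identity. -/

section Isonormal

variable {N : ℕ} {Ω : Type*} [MeasurableSpace Ω] {P : Measure Ω} {W What : L2 N → Ω → ℂ}

/-- A complex isonormal process is homogeneous. -/
theorem IsComplexIsonormal.smul_ae_eq (hW : IsComplexIsonormal W P) (c : ℂ) (f : L2 N) :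
    W (c • f) =ᵐ[P] fun ω => c * W f ω := by
  have hL : ∀ g, MemLp (W g) 2 P := fun g => (hW.gaussian.hasGaussianLaw_eval g).memLp_two
  have hint : ∀ g h, Integrable (fun ω => W g ω * conj (W h ω)) P :=
    fun g h => (hL g).integrable_mul (hL h).star
  have hcov : ∀ g h : L2 N, ∫ ω, W g ω * conj (W h ω) ∂P = inner ℂ h g := by
    intro g h
    rw [hW.covariance, L2.inner_def]
    exact integral_congr_ae (.of_forall fun u => rfl)
  set D : Ω → ℂ := fun ω => W (c • f) ω - c * W f ω with hD
  have hDL : MemLp D 2 P := (hL _).sub ((hL f).const_mul c)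
  -- Expanding E|W(cf) - cW(f)|² by the covariance gives ‖cf - cf‖² = 0.
  have h0 : ∫ ω, D ω * conj (D ω) ∂P = 0 := by
    have e : ∀ ω, D ω * conj (D ω) = W (c • f) ω * conj (W (c • f) ω)
        - conj c * (W (c • f) ω * conj (W f ω)) - c * (W f ω * conj (W (c • f) ω))
        + c * conj c * (W f ω * conj (W f ω)) := by
      intro ω
      simp only [hD, map_sub, map_mul]
      ring
    have i1 := hint (c • f) (c • f)
    have i2 := (hint (c • f) f).const_mul (conj c)
    have i3 := (hint f (c • f)).const_mul c
    have i4 := (hint f f).const_mul (c * conj c)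
    simp only [e]
    rw [integral_add (f := fun ω => _ - _ - _) ((i1.sub i2).sub i3) i4,
      integral_sub (f := fun ω => _ - _) (i1.sub i2) i3, integral_sub i1 i2,
      integral_const_mul, integral_const_mul, integral_const_mul, hcov, hcov, hcov, hcov,
      inner_smul_left, inner_smul_left, inner_smul_right]
    ring
  have h1 : ∫ ω, ‖D ω‖ ^ 2 ∂P = 0 := by
    have : ∀ ω, D ω * conj (D ω) = ((‖D ω‖ ^ 2 : ℝ) : ℂ) := fun ω => by
      rw [Complex.mul_conj, Complex.normSq_eq_norm_sq]
    simp only [this, integral_complex_ofReal] at h0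
    exact_mod_cast h0
  rw [integral_eq_zero_iff_of_nonneg (fun ω => by positivity)
    ((memLp_two_iff_integrable_sq_norm hDL.1).1 hDL)] at h1
  filter_upwards [h1] with ω hω
  exact sub_eq_zero.1 (by simpa using hω)

theorem mBs_ae_eq {H : Index N → Fin N → ℝ} (hH : ∀ t m, H t m ∈ Ioo (0 : ℝ) 1)
    (hW : IsComplexIsonormal W P) (hWhat : IsFourierTransform What W P) (t : Index N) :
    ∀ᵐ ω ∂P, mBs W H t ω
      = ((∏ m, ratio (H t m + 1 / 2) : ℝ) : ℂ) * harmProcess What H t ω := by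
  rw [mBs, harmProcess, stochInt, stochInt, dif_pos (memLp_maKernel hH t),
    dif_pos (memLp_harmKernel hH t), toLp_maKernel_eq hH t]
  filter_upwards [hW.smul_ae_eq ((∏ m, ratio (H t m + 1 / 2) : ℝ) : ℂ)
    (fourierL2 ((memLp_harmKernel hH t).toLp (harmKernel H t))), hWhat _] with ω h1 h2
  rw [h1, h2]

end Isonormal

/-! ### From a countable dense set to all t simultaneously. -/

/-- A map into a second countable space has a countable set of points dense for the induced
topology. -/
theorem exists_countable_comap_nhds_neBot {α β : Type*} [TopologicalSpace β]
    [SecondCountableTopology β] (G : α → β) :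
    ∃ D : Set α, D.Countable ∧ ∀ a, (comap G (𝓝 (G a)) ⊓ 𝓟 D).NeBot := by
  let _ : TopologicalSpace α := .induced G inferInstance
  have : SecondCountableTopology α := TopologicalSpace.secondCountableTopology_induced α β G
  obtain ⟨D, hD, hd⟩ := TopologicalSpace.exists_countable_dense α
  refine ⟨D, hD, fun a => ?_⟩
  rw [← nhds_induced]
  exact mem_closure_iff_clusterPt.1 (hd a)

end MBS

/-- The multifractional Brownian sheet and the harmonizable process agree up to a deterministic
factor: almost surely at each `t`, and, for versions with paths continuous along `H`
(in particular for continuous versions), outside one null set for all `t` simultaneously. -/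
theorem mainTheorem6 (N : ℕ) (H : MBS.Index N → Fin N → ℝ) (hmeas : Measurable H)
    (hH : ∀ t m, H t m ∈ Set.Ioo (0 : ℝ) 1) :
    (∀ t, MemLp (MBS.maKernel H t) 2 volume) ∧
    (∀ t, MemLp (MBS.harmKernel H t) 2 volume) ∧
    ∃ lam : MBS.Index N → ℝ,
      (∀ t, (∀ m, H t m ≠ 1 / 2) → lam t ≠ 0) ∧
      ∀ (Ω : Type*) [MeasurableSpace Ω] (P : Measure Ω) [IsProbabilityMeasure P]
        (W What : MBS.L2 N → Ω → ℂ),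
        MBS.IsComplexIsonormal W P → MBS.IsFourierTransform What W P →
        (∀ t, ∀ᵐ ω ∂P, MBS.mBs W H t ω = (lam t : ℂ) * MBS.harmProcess What H t ω) ∧
        (∀ Y X : MBS.Index N → Ω → ℂ,
          MBS.IsModification Y (MBS.mBs W H) P →
          MBS.IsModification X (MBS.harmProcess What H) P →
          (∀ᵐ ω ∂P, MBS.ContinuousAlong H (fun t => Y t ω)) →
          (∀ᵐ ω ∂P, MBS.ContinuousAlong H (fun t => X t ω)) →
          ∀ᵐ ω ∂P, ∀ t, Y t ω = (lam t : ℂ) * X t ω) := by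
  refine ⟨MBS.memLp_maKernel hH, MBS.memLp_harmKernel hH,
    fun t => ∏ m, MBS.ratio (H t m + 1 / 2), fun t ht => ?_, ?_⟩
  · refine Finset.prod_ne_zero_iff.2 fun m _ => MBS.ratio_ne_zero ?_ ?_ ?_
    · linarith [(hH t m).1]
    · intro h
      exact ht m (by linarith)
    · linarith [(hH t m).2]
  intro Ω _ P _ W What hW hWhat
  refine ⟨MBS.mBs_ae_eq hH hW hWhat, fun Y X hY hX hYc hXc => ?_⟩
  obtain ⟨D, hDc, hD⟩ := MBS.exists_countable_comap_nhds_neBot fun t => (t, H t)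
  have hall : ∀ᵐ ω ∂P, ∀ t ∈ D,
      Y t ω = ((∏ m, MBS.ratio (H t m + 1 / 2) : ℝ) : ℂ) * X t ω := by
    refine (ae_ball_iff hDc).2 fun t _ => ?_
    filter_upwards [hY t, hX t, MBS.mBs_ae_eq hH hW hWhat t] with ω h1 h2 h3
    rw [h1, h2, h3]
  filter_upwards [hall, hYc, hXc] with ω h hy hx t
  -- The filter in `ContinuousAlong` is the neighbourhood filter of the topology induced by t ↦ (t,
  -- H t), so its trace on D is nontrivial even where H is discontinuous.
  have hF : comap (fun t => (t, H t)) (𝓝 (t, H t)) = 𝓝 t ⊓ comap H (𝓝 (H t)) := by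
    rw [nhds_prod_eq, Filter.prod_eq_inf, comap_inf, comap_comap, comap_comap]
    exact congrArg (· ⊓ _) comap_id
  have hne := hD t
  rw [hF] at hne
  have hHt : Tendsto H (𝓝 t ⊓ comap H (𝓝 (H t)) ⊓ 𝓟 D) (𝓝 (H t)) :=
    tendsto_comap.mono_left (inf_le_left.trans inf_le_right)
  have hlam : Tendsto (fun s => ((∏ m, MBS.ratio (H s m + 1 / 2) : ℝ) : ℂ))
      (𝓝 t ⊓ comap H (𝓝 (H t)) ⊓ 𝓟 D) (𝓝 ((∏ m, MBS.ratio (H t m + 1 / 2) : ℝ) : ℂ)) := by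
    refine (Complex.continuous_ofReal.tendsto _).comp (tendsto_finsetProd _ fun m _ => ?_)
    have hpos : 0 < H t m + 1 / 2 := by linarith [(hH t m).1]
    exact (MBS.continuousAt_ratio hpos).tendsto.comp
      ((tendsto_pi_nhds.1 hHt m).add_const (1 / 2))
  -- Along this filter Y_s and λ(s) X_s have limits Y_t and λ(t) X_t, and they coincide on D.
  refine tendsto_nhds_unique_of_eventuallyEq ((hy t).mono_left inf_le_left)
    (hlam.mul ((hx t).mono_left inf_le_left)) ?_
  filter_upwards [mem_inf_of_right (mem_principal_self D)] with s hs using h s hs
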